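/- Let $n,k\ge 0$ be integers and let $f:\{0,1\}^n\to\{0,1\}$ be the $k$-of-$n$ function, i.e. $f(x)=1$ iff at least $k$ of the $x_i$ equal $1$. Let $x_1,\dots,x_n$ be independent random variables, where $x_i=1$ with probability $p_i\in(0,1)$ and $x_i=0$ otherwise. A (deterministic) testing strategy is a finite binary decision tree whose inner nodes are labelled with variables to be tested, the two children corresponding to the outcomes $0$ and $1$, and whose leaves mean stopping (possibly without a certificate); no variable occurs twice on a root–leaf path. Its cost is the number of tests performed. A randomized testing strategy is a probability distribution over testing strategies, independent of the $x_i$. An $\ell$-certificate of $f$ is a partial assignment all of whose full extensions have $f$-value $\ell$; a strategy finds an $\ell$-certificate if the outcomes of its performed tests form one. A pruning of a strategy $T$ is a decision tree obtained from $T$ by replacing some (possibly no) subtrees by leaves; a randomized pruning of $T$ is a probability distribution over prunings of $T$. A strategy is elementary if each of its decisions depends only on the numbers of $0$s and of $1$s observed so far. Let $\mathcal L_0$ be the list of all variables with $p_i\le\frac12$, sorted by decreasing $p_i$, and $\mathcal L_1$ the list of all variables with $p_i>\frac12$, sorted by increasing $p_i$, with ties broken arbitrarily but in a fixed way. InsideOut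 is the round robin between $\mathcal L_0$ and $\mathcal L_1$: as long as the outcomes obtained so far do not form a ($0$- or $1$-)certificate of $f$, it performs the next round, where the $i$-th round consists of testing the $i$-th variable of $\mathcal L_0$ (if it exists) and then the $i$-th variable of $\mathcal L_1$ (if it exists); it does not stop in the middle of a round. Then InsideOut is an elementary testing strategy, and for every randomized testing strategy $S$ with expected cost $B$ that finds a $0$-certificate of $f$ with probability $P$, there is a randomized pruning $S'$ of InsideOut with expected cost at most $6B$ that finds a $0$-certificate of $f$ with probability at least $P$. (Expectations and probabilities are over both the $x_i$ and the internal randomization.) -/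

import Mathlib

open scoped ENNReal

/-- The `k`-of-`n` function: it is `1` iff at least `k` of the `n` variables are `1`. -/
def kOfN (n k : ℕ) (x : Fin n → Bool) : Bool :=
  decide (k ≤ (Finset.univ.filter fun i => x i = true).card)

/-- Partial assignments to `n` Boolean variables; `none` means that no value is assigned. -/
abbrev PartialAssignment (n : ℕ) := Fin n → Option Bool

/-- `σ` is an `ℓ`-certificate of `f`: every full extension of `σ` has value `ℓ` under `f`. -/
def IsCertificate {n : ℕ} (f : (Fin n → Bool) → Bool) (ℓ : Bool) (σ : PartialAssignment n) :
    Prop :=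
  ∀ x : Fin n → Bool, (∀ i b, σ i = some b → x i = b) → f x = ℓ

/-- Binary decision trees. At an inner node a variable is tested; the first subtree is used if
its value is `0`, the second one if its value is `1`. -/
inductive DecTree (n : ℕ) : Type
  | leaf : DecTree n
  | test (i : Fin n) (zero one : DecTree n) : DecTree n

namespace DecTree

variable {n : ℕ}

/-- The set of variables tested somewhere in the tree. -/
def vars : DecTree n → Finset (Fin n)
  | leaf => ∅
  | test i zero one => insert i (zero.vars ∪ one.vars)

/-- A deterministic testing strategy is a decision tree in which no variable occurs twice on a
path from the root. -/
def IsStrategy : DecTree n → Prop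
  | leaf => True
  | test i zero one => i ∉ zero.vars ∧ i ∉ one.vars ∧ zero.IsStrategy ∧ one.IsStrategy

/-- The number of tests performed on the assignment `x`. -/
def cost : DecTree n → (Fin n → Bool) → ℕ
  | leaf, _ => 0
  | test i zero one, x => 1 + if x i = true then one.cost x else zero.cost x

/-- The partial assignment known at termination when the tree is run on `x`, where the outcomes
recorded in `σ` are known beforehand. -/
def run : DecTree n → (Fin n → Bool) → PartialAssignment n → PartialAssignment n
  | leaf, _, σ => σ
  | test i zero one, x, σ =>
      if x i = true then one.run x (Function.update σ i (some true))
      else zero.run x (Function.update σ i (some false))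

/-- The partial assignment consisting of the outcomes of the tests performed on `x`. -/
def outcome (t : DecTree n) (x : Fin n → Bool) : PartialAssignment n :=
  t.run x fun _ => none

/-- The decision made at the root: the variable tested, or `none` for stopping. -/
def decision : DecTree n → Option (Fin n)
  | leaf => none
  | test i _ _ => some i

/-- The subtree at the node reached by a sequence of test outcomes (`none` if the tree has
terminated before). -/
def nodeAt : DecTree n → List Bool → Option (DecTree n)
  | t, [] => some t
  | leaf, _ :: _ => none
  | test _ zero one, b :: h => if b = true then one.nodeAt h else zero.nodeAt h

/-- The decisions depend only on how many `0`s and how many `1`s have been observed. -/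
def IsElementary (t : DecTree n) : Prop :=
  ∀ (h h' : List Bool) (s s' : DecTree n), t.nodeAt h = some s → t.nodeAt h' = some s' →
    h.count false = h'.count false → h.count true = h'.count true → s.decision = s'.decision

/-- `IsPruning t' t`: the tree `t'` is obtained from `t` by terminating at some (possibly no)
nodes of `t`, that is, by replacing the subtrees at these nodes by leaves. -/
inductive IsPruning : DecTree n → DecTree n → Prop
  | leaf (t : DecTree n) : IsPruning DecTree.leaf t
  | test (i : Fin n) {zero' one' zero one : DecTree n} :
      IsPruning zero' zero → IsPruning one' one →
      IsPruning (DecTree.test i zero' one') (DecTree.test i zero one)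

end DecTree

/-- The probability of the assignment `x` when the variables are independent and variable `i` is
`1` with probability `p i`. -/
def assignmentProb {n : ℕ} (p : Fin n → ℝ) (x : Fin n → Bool) : ℝ :=
  ∏ i, if x i = true then p i else 1 - p i

noncomputable section

/-- Expected number of tests of a deterministic strategy. -/
def DecTree.expectedCost {n : ℕ} (p : Fin n → ℝ) (t : DecTree n) : ℝ :=
  ∑ x : Fin n → Bool, assignmentProb p x * (t.cost x : ℝ)

open Classical in
/-- Probability that a deterministic strategy finds an `ℓ`-certificate of `f`. -/
def DecTree.certProb {n : ℕ} (p : Fin n → ℝ) (f : (Fin n → Bool) → Bool) (ℓ : Bool)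
    (t : DecTree n) : ℝ :=
  ∑ x : Fin n → Bool, assignmentProb p x * if IsCertificate f ℓ (t.outcome x) then 1 else 0

/-- A randomized testing strategy: a distribution over deterministic testing strategies. -/
def IsRandomizedStrategy {n : ℕ} (S : PMF (DecTree n)) : Prop :=
  ∀ t ∈ S.support, t.IsStrategy

/-- A randomized pruning of `t`: a distribution over deterministic prunings of `t`. -/
def IsRandomizedPruning {n : ℕ} (S : PMF (DecTree n)) (t : DecTree n) : Prop :=
  ∀ t' ∈ S.support, DecTree.IsPruning t' t

/-- Expected cost of a randomized strategy, over the assignment and, independently, the internal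
randomization. -/
def expectedCost {n : ℕ} (p : Fin n → ℝ) (S : PMF (DecTree n)) : ℝ≥0∞ :=
  ∑' t, S t * ENNReal.ofReal (t.expectedCost p)

/-- Probability that a randomized strategy finds an `ℓ`-certificate of `f`, over the assignment
and, independently, the internal randomization. -/
def certProb {n : ℕ} (p : Fin n → ℝ) (f : (Fin n → Bool) → Bool) (ℓ : Bool)
    (S : PMF (DecTree n)) : ℝ≥0∞ :=
  ∑' t, S t * ENNReal.ofReal (t.certProb p f ℓ)

/-- The rounds of a round robin between two lists: the `i`-th round consists of the `i`-th
element of the first list (if it exists) and the `i`-th element of the second (if it exists). -/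
def roundList {α : Type*} : List α → List α → List (List α)
  | [], B => B.map fun b => [b]
  | a :: A, [] => (a :: A).map fun a' => [a']
  | a :: A, b :: B => [a, b] :: roundList A B

/-- Test all variables in the list, one after the other, and record the outcomes in `σ`; then
continue with the strategy `next` for the resulting partial assignment. -/
def testAll {n : ℕ} : List (Fin n) → PartialAssignment n → (PartialAssignment n → DecTree n) →
    DecTree n
  | [], σ, next => next σ
  | i :: l, σ, next =>
      DecTree.test i (testAll l (Function.update σ i (some false)) next)
        (testAll l (Function.update σ i (some true)) next)

open Classical in
/-- Perform rounds of tests until, at the beginning of a round, the outcomes obtained so far form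
a certificate of `f` (or no round is left). -/
def runRounds {n : ℕ} (f : (Fin n → Bool) → Bool) : List (List (Fin n)) → PartialAssignment n →
    DecTree n
  | [], _ => DecTree.leaf
  | r :: rs, σ =>
      if ∃ ℓ, IsCertificate f ℓ σ then DecTree.leaf else testAll r σ (runRounds f rs)

/-- The round robin testing strategy for `f` between two lists of variables. -/
def roundRobin {n : ℕ} (A B : List (Fin n)) (f : (Fin n → Bool) → Bool) : DecTree n :=
  runRounds f (roundList A B) fun _ => none

/-- `L₀` lists the variables with `p i ≤ 1/2` by decreasing `p i`, and `L₁` lists those with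
`p i > 1/2` by increasing `p i`; ties are broken arbitrarily. -/
structure IsInsideOutOrder {n : ℕ} (p : Fin n → ℝ) (L₀ L₁ : List (Fin n)) : Prop where
  nodup₀ : L₀.Nodup
  nodup₁ : L₁.Nodup
  mem₀ : ∀ i, i ∈ L₀ ↔ p i ≤ 1 / 2
  mem₁ : ∀ i, i ∈ L₁ ↔ 1 / 2 < p i
  decreasing : L₀.Pairwise fun i j => p j ≤ p i
  increasing : L₁.Pairwise fun i j => p i ≤ p j

end

/-! The trade-off between cost and success is handled by Lagrange multipliers. A test costs `c`, and
ending with `z` known zeros earns `g z`, where `g` is the indicator of `n < k + z`. Success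
probability minus `c` times expected cost is then `value`, computed recursively from the number of
zeros alone. It suffices to find, for every `c ≥ 0`, a pruning of InsideOut whose value at price `c`
is at least that of any given strategy at price `4 * c`. Separating the compact polygon of (cost,
success) pairs of randomized prunings from a quadrant then turns these inequalities into one
randomized pruning. The factor obtained is 4, which is below the required 6.

Each of two ideas loses a factor 2. The first is an exchange argument (`value_le_of_test_one`,
`value_le_of_test_zero`). Let a strategy first test `i`, and let `b`, on the same side of `1/2`, be
at least as close to `1/2`. Test `b` first instead. If `b` shows the value likely for that side, let
it play the role of `i`, and let `i` later play that of `b`. Otherwise test `i` at once and imitate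
the original strategy under a suitable coupling. The extra test is needed with probability at most
`1/2`, so it costs at most half a test in expectation. By induction (`value_le_of_ordered`), only
the heads of the two lists need be considered.

The second idea is that a round of InsideOut has at most two tests, so it can imitate the test of
either head at twice its price. The additional outcome does no harm, because having a test done for
free never lowers the optimal value of the remaining rounds (`roundsValue_cons_right_le`,
`roundsValue_cons_left_le`). -/

namespace DecTree

/-! ### Decision trees: value, relabelling, and fixing an outcome. -/

variable {n : ℕ}

/-- The value of a tree when `z` zeros are known: the expected reward `g` of the number of zeros
known at the end minus `c` for every test. -/
def value (g : ℕ → ℝ) (c : ℝ) (p : Fin n → ℝ) : DecTree n → ℕ → ℝ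
  | leaf, z => g z
  | test i zero one, z =>
      -c + (p i * one.value g c p z + (1 - p i) * zero.value g c p (z + 1))

/-- Relabel the variables of a tree. -/
def rename (ρ : Fin n → Fin n) : DecTree n → DecTree n
  | leaf => leaf
  | test i zero one => test (ρ i) (zero.rename ρ) (one.rename ρ)

/-- Remove the test of `b` from a tree, using the outcome `v` for it. -/
def restrict (b : Fin n) (v : Bool) : DecTree n → DecTree n
  | leaf => leaf
  | test i zero one =>
      if i = b then (if v = true then one else zero)
      else test i (zero.restrict b v) (one.restrict b v)

theorem vars_rename (ρ : Fin n → Fin n) (t : DecTree n) :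
    (t.rename ρ).vars = t.vars.image ρ := by
  induction t with
  | leaf => simp [rename, vars]
  | test i t₀ t₁ h₀ h₁ => simp [rename, vars, h₀, h₁, Finset.image_insert, Finset.image_union]

theorem IsStrategy.rename {ρ : Fin n → Fin n} {t : DecTree n} (ht : t.IsStrategy)
    (hρ : Set.InjOn ρ t.vars) : (t.rename ρ).IsStrategy := by
  induction t with
  | leaf => trivial
  | test i t₀ t₁ h₀ h₁ =>
    obtain ⟨hi₀, hi₁, ht₀, ht₁⟩ := ht
    have hi : i ∈ ((test i t₀ t₁).vars : Set (Fin n)) := by simp [vars]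
    have s₀ : (t₀.vars : Set (Fin n)) ⊆ (test i t₀ t₁).vars := by
      intro j hj; simp only [vars, Finset.coe_insert, Finset.coe_union]; exact .inr (.inl hj)
    have s₁ : (t₁.vars : Set (Fin n)) ⊆ (test i t₀ t₁).vars := by
      intro j hj; simp only [vars, Finset.coe_insert, Finset.coe_union]; exact .inr (.inr hj)
    refine ⟨?_, ?_, h₀ ht₀ (hρ.mono s₀), h₁ ht₁ (hρ.mono s₁)⟩
    · rw [vars_rename, Finset.mem_image]
      rintro ⟨j, hj, e⟩
      exact hi₀ (hρ (s₀ hj) hi e ▸ hj)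
    · rw [vars_rename, Finset.mem_image]
      rintro ⟨j, hj, e⟩
      exact hi₁ (hρ (s₁ hj) hi e ▸ hj)

theorem IsStrategy.vars_restrict_subset {t : DecTree n} (ht : t.IsStrategy) (b : Fin n)
    (v : Bool) : (t.restrict b v).vars ⊆ t.vars.erase b := by
  induction t with
  | leaf => simp [restrict, vars]
  | test i t₀ t₁ h₀ h₁ =>
    obtain ⟨hi₀, hi₁, ht₀, ht₁⟩ := ht
    have h₀ := h₀ ht₀
    have h₁ := h₁ ht₁
    intro j hj
    by_cases hib : i = b
    · subst hib
      cases v <;> simp [restrict, vars] at hj ⊢ <;> grind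
    · simp only [restrict, hib, if_false, vars, Finset.mem_insert, Finset.mem_union] at hj
      simp only [vars, Finset.mem_insert, Finset.mem_union, Finset.mem_erase]
      rcases hj with rfl | hj | hj
      · exact ⟨hib, .inl rfl⟩
      · have := Finset.mem_erase.1 (h₀ hj); tauto
      · have := Finset.mem_erase.1 (h₁ hj); tauto

theorem IsStrategy.restrict {t : DecTree n} (ht : t.IsStrategy) (b : Fin n) (v : Bool) :
    (t.restrict b v).IsStrategy := by
  induction t with
  | leaf => trivial
  | test i t₀ t₁ h₀ h₁ =>
    obtain ⟨hi₀, hi₁, ht₀, ht₁⟩ := ht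
    by_cases hib : i = b
    · cases v <;> simpa [DecTree.restrict, hib]
    · simp only [DecTree.restrict, hib, if_false]
      exact ⟨fun h => hi₀ (Finset.mem_of_mem_erase (ht₀.vars_restrict_subset b v h)),
        fun h => hi₁ (Finset.mem_of_mem_erase (ht₁.vars_restrict_subset b v h)), h₀ ht₀, h₁ ht₁⟩

/-! ### The exchange argument. -/

section Value

variable {g : ℕ → ℝ} {c : ℝ}

theorem value_rename (p : Fin n → ℝ) (ρ : Fin n → Fin n) (t : DecTree n) (z : ℕ) :
    (t.rename ρ).value g c p z = t.value g c (fun j => p (ρ j)) z := by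
  induction t generalizing z with
  | leaf => rfl
  | test i t₀ t₁ h₀ h₁ => simp [rename, value, h₀, h₁]

theorem value_congr {p p' : Fin n → ℝ} {t : DecTree n} (h : ∀ i ∈ t.vars, p i = p' i) (z : ℕ) :
    t.value g c p z = t.value g c p' z := by
  induction t generalizing z with
  | leaf => rfl
  | test i t₀ t₁ h₀ h₁ =>
    simp only [vars, Finset.mem_insert, Finset.mem_union] at h
    simp only [value]
    rw [h₀ fun j hj => h j (.inr (.inl hj)), h₁ fun j hj => h j (.inr (.inr hj)), h i (.inl rfl)]

theorem value_update_of_notMem {p : Fin n → ℝ} {t : DecTree n} {b : Fin n} (hb : b ∉ t.vars)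
    (r : ℝ) (z : ℕ) : t.value g c (Function.update p b r) z = t.value g c p z :=
  value_congr (fun i hi => Function.update_of_ne (by rintro rfl; exact hb hi) _ _) z

/-- Conditioning on the outcome of `b`: since `b` occurs at most once on each path, the value is
affine in its probability. -/
theorem value_eq_update {t : DecTree n} (ht : t.IsStrategy) (p : Fin n → ℝ) (b : Fin n) (r : ℝ)
    (z : ℕ) : t.value g c (Function.update p b r) z =
      r * t.value g c (Function.update p b 1) z +
        (1 - r) * t.value g c (Function.update p b 0) z := by
  induction t generalizing z with
  | leaf => simp only [value]; ring
  | test i t₀ t₁ h₀ h₁ =>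
    obtain ⟨hi₀, hi₁, ht₀, ht₁⟩ := ht
    by_cases hib : i = b
    · subst hib
      simp only [value, Function.update_self, value_update_of_notMem hi₀,
        value_update_of_notMem hi₁]
      ring
    · simp only [value, Function.update_of_ne hib]
      rw [h₀ ht₀, h₁ ht₁]
      ring

/-- A test with a certain outcome can be skipped, which saves its price; an outcome `1` leaves the
count of zeros unchanged. -/
theorem value_update_one_le {p : Fin n → ℝ} (hp : ∀ i, 0 ≤ p i ∧ p i ≤ 1) (hc : 0 ≤ c)
    {t : DecTree n} (ht : t.IsStrategy) (b : Fin n) (z : ℕ) :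
    t.value g c (Function.update p b 1) z ≤ (t.restrict b true).value g c p z := by
  induction t generalizing z with
  | leaf => exact le_rfl
  | test i t₀ t₁ h₀ h₁ =>
    obtain ⟨hi₀, hi₁, ht₀, ht₁⟩ := ht
    by_cases hib : i = b
    · subst hib
      simp only [value, restrict, Function.update_self, value_update_of_notMem hi₁, if_true]
      linarith
    · simp only [restrict, if_neg hib, value, Function.update_of_ne hib]
      have := mul_le_mul_of_nonneg_left (h₁ ht₁ z) (hp i).1
      have := mul_le_mul_of_nonneg_left (h₀ ht₀ (z + 1)) (sub_nonneg.2 (hp i).2)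
      linarith

/-- As for outcome `1`, but the zero of `b` is credited at the start. Paths that never test `b` also
receive this credit, hence the need for `g` to be monotone. -/
theorem value_update_zero_le {p : Fin n → ℝ} (hp : ∀ i, 0 ≤ p i ∧ p i ≤ 1) (hc : 0 ≤ c)
    (hg : Monotone g) {t : DecTree n} (ht : t.IsStrategy) (b : Fin n) (z : ℕ) :
    t.value g c (Function.update p b 0) z ≤ (t.restrict b false).value g c p (z + 1) := by
  induction t generalizing z with
  | leaf => exact hg (Nat.le_succ z)
  | test i t₀ t₁ h₀ h₁ =>
    obtain ⟨hi₀, hi₁, ht₀, ht₁⟩ := ht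
    by_cases hib : i = b
    · subst hib
      simp only [value, restrict, Function.update_self, value_update_of_notMem hi₀, if_true]
      simp
      linarith
    · simp only [restrict, if_neg hib, value, Function.update_of_ne hib]
      have := mul_le_mul_of_nonneg_left (h₁ ht₁ z) (hp i).1
      have := mul_le_mul_of_nonneg_left (h₀ ht₀ (z + 1)) (sub_nonneg.2 (hp i).2)
      linarith

/-- Replacing `b` by a variable `i` that is not tested gives a strategy. -/
theorem IsStrategy.replace {t : DecTree n} (ht : t.IsStrategy) {i b : Fin n} (hi : i ∉ t.vars)
    {R : Finset (Fin n)} (hR : t.vars ⊆ insert b R) (hiR : i ∈ R) :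
    (t.rename (Function.update id b i)).IsStrategy ∧
      (t.rename (Function.update id b i)).vars ⊆ R := by
  refine ⟨ht.rename ?_, ?_⟩
  · intro x hx y hy h
    have hx' : x ≠ i := fun e => hi (e ▸ hx)
    have hy' : y ≠ i := fun e => hi (e ▸ hy)
    simp only [Function.update_apply, id] at h
    split_ifs at h <;> grind
  · rw [vars_rename]
    intro x hx
    obtain ⟨y, hy, rfl⟩ := Finset.mem_image.1 hx
    have := hR hy
    simp only [Function.update_apply, id]
    split_ifs <;> grind

theorem value_replace (p : Fin n → ℝ) {i b : Fin n} (t : DecTree n) (z : ℕ) :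
    (t.rename (Function.update id b i)).value g c p z =
      t.value g c (Function.update p b (p i)) z := by
  rw [value_rename]
  congr 1
  ext j
  by_cases h : j = b <;> simp [h]

/-- If `b` is at least as uncertain as `i` and likely to be `1`, then a strategy starting with `i`
can be replaced by one starting with `b`, at twice the cost. -/
theorem value_le_of_test_one {p : Fin n → ℝ} (hp : ∀ i, 0 < p i ∧ p i < 1) {μ : ℝ} (hμ : 0 ≤ μ)
    (hg : Monotone g) {R : Finset (Fin n)} {w : ℕ → ℝ}
    (hw : ∀ t : DecTree n, t.IsStrategy → t.vars ⊆ R → ∀ z, t.value g (2 * μ) p z ≤ w z)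
    {b i : Fin n} (hb : 1 / 2 ≤ p b) (hbi : p b ≤ p i) (hiR : i ∈ R)
    {t₀ t₁ : DecTree n} (ht : (test i t₀ t₁).IsStrategy) (h₀ : t₀.vars ⊆ insert b R)
    (h₁ : t₁.vars ⊆ insert b R) (z : ℕ) :
    (test i t₀ t₁).value g (2 * μ) p z ≤ -μ + (p b * w z + (1 - p b) * w (z + 1)) := by
  obtain ⟨hi₀, hi₁, ht₀, ht₁⟩ := ht
  have hp' : ∀ i, 0 ≤ p i ∧ p i ≤ 1 := fun i => ⟨(hp i).1.le, (hp i).2.le⟩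
  have hc : 0 ≤ 2 * μ := by linarith
  have sub : ∀ {t : DecTree n} (v : Bool), t.IsStrategy → i ∉ t.vars → t.vars ⊆ insert b R →
      (t.restrict b v).IsStrategy ∧ (t.restrict b v).vars ⊆ R ∧ i ∉ (t.restrict b v).vars := by
    intro t v ht hi h
    have := ht.vars_restrict_subset b v
    refine ⟨ht.restrict b v, fun x hx => ?_, fun hx => hi (Finset.mem_of_mem_erase (this hx))⟩
    have := Finset.mem_erase.1 (this hx)
    exact (Finset.mem_insert.1 (h this.2)).resolve_left this.1
  have key : ∀ {s₀ s₁ : DecTree n}, s₀.IsStrategy ∧ s₀.vars ⊆ R ∧ i ∉ s₀.vars →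
      s₁.IsStrategy ∧ s₁.vars ⊆ R ∧ i ∉ s₁.vars →
      (test i s₀ s₁).value g (2 * μ) p (z + 1) ≤ w (z + 1) := by
    intro s₀ s₁ a₀ a₁
    refine hw (test i s₀ s₁) ⟨a₀.2.2, a₁.2.2, a₀.1, a₁.1⟩ ?_ _
    simp only [vars]
    exact Finset.insert_subset hiR (Finset.union_subset a₀.2.1 a₁.2.1)
  -- Split both subtrees according to the outcome of `b`, giving four values weighted by the joint
  -- law of `i` and `b`.
  have e₁ := value_eq_update (g := g) (c := 2 * μ) ht₁ p b (p b) z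
  have e₀ := value_eq_update (g := g) (c := 2 * μ) ht₀ p b (p b) (z + 1)
  rw [Function.update_eq_self] at e₀ e₁
  -- Case `b = 1`: continue with `t₁` as if `i = 1` had been seen, with `i` in the role of `b`.
  have f₁ := hw _ (ht₁.replace hi₁ h₁ hiR).1 (ht₁.replace hi₁ h₁ hiR).2 z
  rw [value_replace, value_eq_update ht₁] at f₁
  -- Case `b = 0`: test `i` at once. In `k₁` the original strategy continues with `b` known to be
  -- `0`; in `k₂` the roles of `i` and `b` are exchanged.
  have k₁ := key (sub false ht₀ hi₀ h₀) (sub false ht₁ hi₁ h₁)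
  have k₂ := key (sub false ht₀ hi₀ h₀) (sub true ht₀ hi₀ h₀)
  simp only [value] at k₁ k₂ ⊢
  have l₁ := value_update_zero_le hp' hc hg ht₁ b z
  have l₂ := value_update_zero_le hp' hc hg ht₀ b (z + 1)
  have l₃ := value_update_one_le (g := g) hp' hc ht₀ b (z + 1)
  rw [e₁, e₀]
  generalize value g (2 * μ) (Function.update p b 1) t₁ z = a₁ at *
  generalize value g (2 * μ) (Function.update p b 0) t₁ z = a₀ at *
  generalize value g (2 * μ) (Function.update p b 1) t₀ (z + 1) = c₁ at *
  generalize value g (2 * μ) (Function.update p b 0) t₀ (z + 1) = c₀ at *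
  have hpi := hp i
  have hpb := hp b
  have k₁' : -(2 * μ) + (p i * a₀ + (1 - p i) * c₀) ≤ w (z + 1) := by
    refine le_trans ?_ k₁
    have := mul_le_mul_of_nonneg_left l₁ hpi.1.le
    have := mul_le_mul_of_nonneg_left l₂ (sub_nonneg.2 hpi.2.le)
    linarith
  have k₂' : -(2 * μ) + (p i * c₁ + (1 - p i) * c₀) ≤ w (z + 1) := by
    refine le_trans ?_ k₂
    have := mul_le_mul_of_nonneg_left l₃ hpi.1.le
    have := mul_le_mul_of_nonneg_left l₂ (sub_nonneg.2 hpi.2.le)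
    linarith
  -- Given `b = 0`, the probabilities of `k₂` and `k₁` are `p b * (1 - p i)` and `p i - p b`, each
  -- divided by `p i * (1 - p b)`; this reproduces the joint law of the simulated outcomes.
  -- Multiplication by `p i` clears denominators. The extra charge is `(1 - p b) * (2 * μ) ≤ μ`.
  have m₁ := mul_le_mul_of_nonneg_left f₁ hpb.1.le
  have m₂ := mul_le_mul_of_nonneg_left k₂' (mul_nonneg hpb.1.le (sub_nonneg.2 hpi.2.le))
  have m₃ := mul_le_mul_of_nonneg_left k₁' (sub_nonneg.2 hbi)
  have m₄ := mul_nonneg hμ (sub_nonneg.2 hb)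
  refine le_of_mul_le_mul_left ?_ hpi.1
  have m₁' := mul_le_mul_of_nonneg_left m₁ hpi.1.le
  have m₄' := mul_nonneg hpi.1.le m₄
  linarith

/-- If `b` is at least as uncertain as `i` and likely to be `0`, then a strategy starting with `i`
can be replaced by one starting with `b`, at twice the cost. -/
theorem value_le_of_test_zero {p : Fin n → ℝ} (hp : ∀ i, 0 < p i ∧ p i < 1) {μ : ℝ} (hμ : 0 ≤ μ)
    (hg : Monotone g) {R : Finset (Fin n)} {w : ℕ → ℝ}
    (hw : ∀ t : DecTree n, t.IsStrategy → t.vars ⊆ R → ∀ z, t.value g (2 * μ) p z ≤ w z)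
    {b i : Fin n} (hb : p b ≤ 1 / 2) (hbi : p i ≤ p b) (hiR : i ∈ R)
    {t₀ t₁ : DecTree n} (ht : (test i t₀ t₁).IsStrategy) (h₀ : t₀.vars ⊆ insert b R)
    (h₁ : t₁.vars ⊆ insert b R) (z : ℕ) :
    (test i t₀ t₁).value g (2 * μ) p z ≤ -μ + (p b * w z + (1 - p b) * w (z + 1)) := by
  obtain ⟨hi₀, hi₁, ht₀, ht₁⟩ := ht
  have hp' : ∀ i, 0 ≤ p i ∧ p i ≤ 1 := fun i => ⟨(hp i).1.le, (hp i).2.le⟩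
  have hc : 0 ≤ 2 * μ := by linarith
  have sub : ∀ {t : DecTree n} (v : Bool), t.IsStrategy → i ∉ t.vars → t.vars ⊆ insert b R →
      (t.restrict b v).IsStrategy ∧ (t.restrict b v).vars ⊆ R ∧ i ∉ (t.restrict b v).vars := by
    intro t v ht hi h
    have := ht.vars_restrict_subset b v
    refine ⟨ht.restrict b v, fun x hx => ?_, fun hx => hi (Finset.mem_of_mem_erase (this hx))⟩
    have := Finset.mem_erase.1 (this hx)
    exact (Finset.mem_insert.1 (h this.2)).resolve_left this.1
  have key : ∀ {s₀ s₁ : DecTree n}, s₀.IsStrategy ∧ s₀.vars ⊆ R ∧ i ∉ s₀.vars →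
      s₁.IsStrategy ∧ s₁.vars ⊆ R ∧ i ∉ s₁.vars →
      (test i s₀ s₁).value g (2 * μ) p z ≤ w z := by
    intro s₀ s₁ a₀ a₁
    refine hw (test i s₀ s₁) ⟨a₀.2.2, a₁.2.2, a₀.1, a₁.1⟩ ?_ _
    simp only [vars]
    exact Finset.insert_subset hiR (Finset.union_subset a₀.2.1 a₁.2.1)
  have e₁ := value_eq_update (g := g) (c := 2 * μ) ht₁ p b (p b) z
  have e₀ := value_eq_update (g := g) (c := 2 * μ) ht₀ p b (p b) (z + 1)
  rw [Function.update_eq_self] at e₀ e₁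
  -- Mirror image: `b = 0` stands in for `i = 0`, and the extra test of `i` occurs only if `b = 1`.
  have f₁ := hw _ (ht₀.replace hi₀ h₀ hiR).1 (ht₀.replace hi₀ h₀ hiR).2 (z + 1)
  rw [value_replace, value_eq_update ht₀] at f₁
  have k₁ := key (sub true ht₀ hi₀ h₀) (sub true ht₁ hi₁ h₁)
  have k₂ := key (sub false ht₁ hi₁ h₁) (sub true ht₁ hi₁ h₁)
  simp only [value] at k₁ k₂ ⊢
  have l₁ := value_update_zero_le hp' hc hg ht₁ b z
  have l₂ := value_update_one_le (g := g) hp' hc ht₁ b z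
  have l₃ := value_update_one_le (g := g) hp' hc ht₀ b (z + 1)
  rw [e₁, e₀]
  generalize value g (2 * μ) (Function.update p b 1) t₁ z = a₁ at *
  generalize value g (2 * μ) (Function.update p b 0) t₁ z = a₀ at *
  generalize value g (2 * μ) (Function.update p b 1) t₀ (z + 1) = c₁ at *
  generalize value g (2 * μ) (Function.update p b 0) t₀ (z + 1) = c₀ at *
  have hpi := hp i
  have hpb := hp b
  have k₁' : -(2 * μ) + (p i * a₁ + (1 - p i) * c₁) ≤ w z := by
    refine le_trans ?_ k₁
    have := mul_le_mul_of_nonneg_left l₂ hpi.1.le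
    have := mul_le_mul_of_nonneg_left l₃ (sub_nonneg.2 hpi.2.le)
    linarith
  have k₂' : -(2 * μ) + (p i * a₁ + (1 - p i) * a₀) ≤ w z := by
    refine le_trans ?_ k₂
    have := mul_le_mul_of_nonneg_left l₂ hpi.1.le
    have := mul_le_mul_of_nonneg_left l₁ (sub_nonneg.2 hpi.2.le)
    linarith
  have m₁ := mul_le_mul_of_nonneg_left f₁ (sub_nonneg.2 hpb.2.le)
  have m₂ := mul_le_mul_of_nonneg_left k₂' (mul_nonneg (sub_nonneg.2 hpb.2.le) hpi.1.le)
  have m₃ := mul_le_mul_of_nonneg_left k₁' (sub_nonneg.2 hbi)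
  have m₄ := mul_nonneg hμ (sub_nonneg.2 hb)
  refine le_of_mul_le_mul_left ?_ (sub_pos.2 hpi.2)
  have m₁' := mul_le_mul_of_nonneg_left m₁ (sub_nonneg.2 hpi.2.le)
  have m₄' := mul_nonneg (sub_nonneg.2 hpi.2.le) m₄
  linarith

/-- Any function of the remaining variables that dominates stopping and testing the first variable
of either list at cost `μ` dominates every strategy with cost `2 * μ` per test. -/
theorem value_le_of_ordered {p : Fin n → ℝ} (hp : ∀ i, 0 < p i ∧ p i < 1) {μ : ℝ} (hμ : 0 ≤ μ)
    (hg : Monotone g) {W : List (Fin n) → List (Fin n) → ℕ → ℝ} (hW : ∀ A B z, g z ≤ W A B z)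
    (hWA : ∀ a A B z, -μ + (p a * W A B z + (1 - p a) * W A B (z + 1)) ≤ W (a :: A) B z)
    (hWB : ∀ A b B z, -μ + (p b * W A B z + (1 - p b) * W A B (z + 1)) ≤ W A (b :: B) z)
    (N : ℕ) : ∀ (A B : List (Fin n)), A.length + B.length = N →
      (∀ i ∈ A, p i ≤ 1 / 2) → (∀ i ∈ B, 1 / 2 ≤ p i) →
      A.Pairwise (fun i j => p j ≤ p i) → B.Pairwise (fun i j => p i ≤ p j) →
      ∀ t : DecTree n, t.IsStrategy → t.vars ⊆ A.toFinset ∪ B.toFinset → ∀ z,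
        t.value g (2 * μ) p z ≤ W A B z := by
  have hp' : ∀ i, 0 ≤ p i ∧ p i ≤ 1 := fun i => ⟨(hp i).1.le, (hp i).2.le⟩
  induction N with
  | zero =>
    rintro A B hN - - - - t - hv z
    obtain ⟨rfl, rfl⟩ : A = [] ∧ B = [] := by
      constructor <;> apply List.length_eq_zero_iff.1 <;> omega
    cases t with
    | leaf => exact hW _ _ _
    | test i t₀ t₁ =>
      have := hv (Finset.mem_insert_self i _)
      simp at this
  | succ N ih =>
    intro A B hN hA hB sA sB t ht hv z
    cases t with
    | leaf => exact hW _ _ _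
    | test i t₀ t₁ =>
      have hi : i ∈ A.toFinset ∪ B.toFinset := hv (Finset.mem_insert_self i _)
      have hv₀ : t₀.vars ⊆ A.toFinset ∪ B.toFinset := fun x hx =>
        hv (Finset.mem_insert_of_mem (Finset.mem_union_left _ hx))
      have hv₁ : t₁.vars ⊆ A.toFinset ∪ B.toFinset := fun x hx =>
        hv (Finset.mem_insert_of_mem (Finset.mem_union_right _ hx))
      -- If the root already tests the head of its list, no exchange is needed.
      have same : ∀ {w : ℕ → ℝ} {R : Finset (Fin n)},
          (∀ t : DecTree n, t.IsStrategy → t.vars ⊆ R → ∀ z, t.value g (2 * μ) p z ≤ w z) →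
          t₀.vars ⊆ insert i R → t₁.vars ⊆ insert i R →
          (test i t₀ t₁).value g (2 * μ) p z ≤ -μ + (p i * w z + (1 - p i) * w (z + 1)) := by
        intro w R hw h₀ h₁
        have a₀ := hw t₀ ht.2.2.1 (fun x hx => (Finset.mem_insert.1 (h₀ hx)).resolve_left
          fun e => ht.1 (e ▸ hx)) (z + 1)
        have a₁ := hw t₁ ht.2.2.2 (fun x hx => (Finset.mem_insert.1 (h₁ hx)).resolve_left
          fun e => ht.2.1 (e ▸ hx)) z
        have := mul_le_mul_of_nonneg_left a₁ (hp' i).1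
        have := mul_le_mul_of_nonneg_left a₀ (sub_nonneg.2 (hp' i).2)
        simp only [value]
        linarith
      rcases Finset.mem_union.1 hi with hi | hi
      · rw [List.mem_toFinset] at hi
        cases A with
        | nil => simp at hi
        | cons a A =>
          have hw := ih A B (by simp only [List.length_cons] at hN; omega)
            (fun j hj => hA j (List.mem_cons_of_mem _ hj)) hB (List.pairwise_cons.1 sA).2 sB
          rw [List.toFinset_cons, Finset.insert_union] at hv₀ hv₁
          refine le_trans ?_ (hWA a A B z)
          by_cases hia : i = a
          · subst hia
            exact same hw hv₀ hv₁
          · have hiA := (List.mem_cons.1 hi).resolve_left hia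
            exact value_le_of_test_zero hp hμ hg hw (hA a List.mem_cons_self)
              ((List.pairwise_cons.1 sA).1 i hiA)
              (Finset.mem_union_left _ (List.mem_toFinset.2 hiA)) ht hv₀ hv₁ z
      · rw [List.mem_toFinset] at hi
        cases B with
        | nil => simp at hi
        | cons b B =>
          have hw := ih A B (by simp only [List.length_cons] at hN; omega) hA
            (fun j hj => hB j (List.mem_cons_of_mem _ hj)) sA (List.pairwise_cons.1 sB).2
          rw [List.toFinset_cons, Finset.union_insert] at hv₀ hv₁
          refine le_trans ?_ (hWB A b B z)
          by_cases hib : i = b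
          · subst hib
            exact same hw hv₀ hv₁
          · have hiB := (List.mem_cons.1 hi).resolve_left hib
            exact value_le_of_test_one hp hμ hg hw (hB b List.mem_cons_self)
              ((List.pairwise_cons.1 sB).1 i hiB)
              (Finset.mem_union_right _ (List.mem_toFinset.2 hiB)) ht hv₀ hv₁ z

end Value

end DecTree

/-! ### Optimal stopping between rounds. -/

section Rounds

variable {n : ℕ} {g : ℕ → ℝ} {c : ℝ} {p : Fin n → ℝ}

/-- The expected value of `F`, a function of the number of known zeros, after testing all variables
in a list. -/
def listExpect (p : Fin n → ℝ) : List (Fin n) → (ℕ → ℝ) → ℕ → ℝ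
  | [], F, z => F z
  | i :: l, F, z => p i * listExpect p l F z + (1 - p i) * listExpect p l F (z + 1)

/-- The largest value of a strategy that performs rounds of tests and may stop after any round. -/
noncomputable def roundsValue (g : ℕ → ℝ) (c : ℝ) (p : Fin n → ℝ) :
    List (List (Fin n)) → ℕ → ℝ
  | [], z => g z
  | r :: rs, z => max (g z) (-(c * r.length) + listExpect p r (roundsValue g c p rs) z)

theorem listExpect_mono (hp : ∀ i, 0 ≤ p i ∧ p i ≤ 1) (l : List (Fin n)) {F G : ℕ → ℝ}
    (h : ∀ z, F z ≤ G z) (z : ℕ) : listExpect p l F z ≤ listExpect p l G z := by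
  induction l generalizing z with
  | nil => exact h z
  | cons i l ih =>
    have := mul_le_mul_of_nonneg_left (ih z) (hp i).1
    have := mul_le_mul_of_nonneg_left (ih (z + 1)) (sub_nonneg.2 (hp i).2)
    simp only [listExpect]
    linarith

theorem le_roundsValue (rs : List (List (Fin n))) (z : ℕ) : g z ≤ roundsValue g c p rs z := by
  cases rs with
  | nil => exact le_rfl
  | cons r rs => exact le_max_left _ _

theorem le_expect_roundsValue (hp : ∀ i, 0 ≤ p i ∧ p i ≤ 1) (hg : Monotone g) (i : Fin n)
    (rs : List (List (Fin n))) (z : ℕ) :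
    g z ≤ p i * roundsValue g c p rs z + (1 - p i) * roundsValue g c p rs (z + 1) := by
  have := mul_le_mul_of_nonneg_left (le_roundsValue (c := c) (p := p) (g := g) rs z) (hp i).1
  have := mul_le_mul_of_nonneg_left ((hg (Nat.le_succ z)).trans
    (le_roundsValue (c := c) (p := p) (g := g) rs (z + 1))) (sub_nonneg.2 (hp i).2)
  linarith

/-- Knowing the outcome of `b` for free is at least as good as having it at the head of the list.
With `b` gone, its place in the round goes to the next variable of `B`, which recursively may be
regarded as tested for free in the later rounds. -/
theorem roundsValue_cons_right_le (hp : ∀ i, 0 ≤ p i ∧ p i ≤ 1) (hc : 0 ≤ c) (hg : Monotone g)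
    (A : List (Fin n)) (b : Fin n) (B : List (Fin n)) (z : ℕ) :
    roundsValue g c p (roundList A (b :: B)) z ≤
      p b * roundsValue g c p (roundList A B) z +
        (1 - p b) * roundsValue g c p (roundList A B) (z + 1) := by
  induction A generalizing b B z with
  | nil =>
    have : roundList [] (b :: B) = [b] :: roundList [] B := by simp [roundList]
    rw [this]
    refine max_le (le_expect_roundsValue hp hg _ _ _) ?_
    simp [listExpect]
    linarith
  | cons a A ih =>
    refine max_le (le_expect_roundsValue hp hg _ _ _) ?_
    have e₀ := (hp b).1
    have e₁ := sub_nonneg.2 (hp b).2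
    cases B with
    | nil =>
      have h : roundList (a :: A) [] = [a] :: roundList A [] := by cases A <;> simp [roundList]
      rw [h]
      have k := fun z => le_max_right (g z)
        (-(c * ([a] : List (Fin n)).length) +
          listExpect p [a] (roundsValue g c p (roundList A [])) z)
      have k₁ := mul_le_mul_of_nonneg_left (k z) e₀
      have k₂ := mul_le_mul_of_nonneg_left (k (z + 1)) e₁
      simp only [roundsValue, listExpect, List.length_cons, List.length_nil] at k₁ k₂ ⊢
      push_cast at k₁ k₂ ⊢
      linarith
    | cons b' B =>
      have k := fun z => le_max_right (g z) (-(c * ([a, b'] : List (Fin n)).length) +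
          listExpect p [a, b'] (roundsValue g c p (roundList A B)) z)
      have k₁ := mul_le_mul_of_nonneg_left (k z) e₀
      have k₂ := mul_le_mul_of_nonneg_left (k (z + 1)) e₁
      have ih' := listExpect_mono hp [a, b] (ih b' B) z
      simp only [roundList, roundsValue, listExpect, List.length_cons, List.length_nil]
        at k₁ k₂ ih' ⊢
      push_cast at k₁ k₂ ih' ⊢
      linarith

theorem roundsValue_cons_left_le (hp : ∀ i, 0 ≤ p i ∧ p i ≤ 1) (hc : 0 ≤ c) (hg : Monotone g)
    (a : Fin n) (A B : List (Fin n)) (z : ℕ) :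
    roundsValue g c p (roundList (a :: A) B) z ≤
      p a * roundsValue g c p (roundList A B) z +
        (1 - p a) * roundsValue g c p (roundList A B) (z + 1) := by
  induction B generalizing a A z with
  | nil =>
    have : roundList (a :: A) [] = [a] :: roundList A [] := by cases A <;> simp [roundList]
    rw [this]
    refine max_le (le_expect_roundsValue hp hg _ _ _) ?_
    simp [listExpect]
    linarith
  | cons b B ih =>
    refine max_le (le_expect_roundsValue hp hg _ _ _) ?_
    have e₀ := (hp a).1
    have e₁ := sub_nonneg.2 (hp a).2
    cases A with
    | nil =>
      have h : roundList [] (b :: B) = [b] :: roundList [] B := by simp [roundList]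
      rw [h]
      have k := fun z => le_max_right (g z)
        (-(c * ([b] : List (Fin n)).length) +
          listExpect p [b] (roundsValue g c p (roundList [] B)) z)
      have k₁ := mul_le_mul_of_nonneg_left (k z) e₀
      have k₂ := mul_le_mul_of_nonneg_left (k (z + 1)) e₁
      simp only [roundsValue, listExpect, List.length_cons, List.length_nil] at k₁ k₂ ⊢
      push_cast at k₁ k₂ ⊢
      linarith
    | cons a' A =>
      have k := fun z => le_max_right (g z) (-(c * ([a', b] : List (Fin n)).length) +
          listExpect p [a', b] (roundsValue g c p (roundList A B)) z)
      have k₁ := mul_le_mul_of_nonneg_left (k z) e₀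
      have k₂ := mul_le_mul_of_nonneg_left (k (z + 1)) e₁
      have ih' := listExpect_mono hp [a, b] (ih a' A) z
      simp only [roundList, roundsValue, listExpect, List.length_cons, List.length_nil]
        at k₁ k₂ ih' ⊢
      push_cast at k₁ k₂ ih' ⊢
      linarith

/-- The first round tests `a` and at most one further variable, so it costs at most `2 * c`; by
`roundsValue_cons_right_le` the further outcome is no disadvantage. -/
theorem le_roundsValue_cons_left (hp : ∀ i, 0 ≤ p i ∧ p i ≤ 1) (hc : 0 ≤ c) (hg : Monotone g)
    (a : Fin n) (A B : List (Fin n)) (z : ℕ) :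
    -(2 * c) + (p a * roundsValue g c p (roundList A B) z +
        (1 - p a) * roundsValue g c p (roundList A B) (z + 1)) ≤
      roundsValue g c p (roundList (a :: A) B) z := by
  cases B with
  | nil =>
    have : roundList (a :: A) [] = [a] :: roundList A [] := by cases A <;> simp [roundList]
    rw [this]
    refine le_trans ?_ (le_max_right _ _)
    simp [listExpect]
    linarith
  | cons b B =>
    refine le_trans ?_ (le_max_right _ _)
    have := listExpect_mono hp [a] (roundsValue_cons_right_le hp hc hg A b B) z
    simp only [listExpect, List.length_cons, List.length_nil] at this ⊢
    push_cast at this ⊢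
    linarith

theorem le_roundsValue_cons_right (hp : ∀ i, 0 ≤ p i ∧ p i ≤ 1) (hc : 0 ≤ c) (hg : Monotone g)
    (A : List (Fin n)) (b : Fin n) (B : List (Fin n)) (z : ℕ) :
    -(2 * c) + (p b * roundsValue g c p (roundList A B) z +
        (1 - p b) * roundsValue g c p (roundList A B) (z + 1)) ≤
      roundsValue g c p (roundList A (b :: B)) z := by
  cases A with
  | nil =>
    have : roundList [] (b :: B) = [b] :: roundList [] B := by simp [roundList]
    rw [this]
    refine le_trans ?_ (le_max_right _ _)
    simp [listExpect]
    linarith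
  | cons a A =>
    refine le_trans ?_ (le_max_right _ _)
    have := listExpect_mono hp [b] (roundsValue_cons_left_le hp hc hg a A B) z
    simp only [listExpect, List.length_cons, List.length_nil] at this ⊢
    push_cast at this ⊢
    linarith

end Rounds

/-! ### Certificates of the threshold function as counts of zeros and ones. -/

section Certificates

variable {n : ℕ}

/-- The number of variables that have value `b` in `σ`. -/
def PartialAssignment.num (b : Bool) (σ : PartialAssignment n) : ℕ :=
  (Finset.univ.filter fun i => σ i = some b).card

open PartialAssignment

theorem num_none (b : Bool) : num b (fun _ : Fin n => none) = 0 := by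
  simp [num]

theorem num_update {σ : PartialAssignment n} {i : Fin n} (h : σ i = none) (b v : Bool) :
    num b (Function.update σ i (some v)) = num b σ + if v = b then 1 else 0 := by
  unfold num
  by_cases hv : v = b
  · subst hv
    have : (Finset.univ.filter fun j => Function.update σ i (some v) j = some v) =
        insert i (Finset.univ.filter fun j => σ j = some v) := by
      ext j
      by_cases hj : j = i
      · subst hj; simp
      · simp [hj]
    rw [this, Finset.card_insert_of_notMem (by simp [h]), if_pos rfl]
  · rw [if_neg hv, add_zero]
    congr 1
    ext j
    by_cases hj : j = i
    · subst hj; simp [h, hv]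
    · simp [hj]

theorem num_add_num_add_length_le {σ : PartialAssignment n} {l : List (Fin n)} (hl : l.Nodup)
    (h : ∀ i ∈ l, σ i = none) : num false σ + num true σ + l.length ≤ n := by
  rw [← List.toFinset_card_of_nodup hl]
  unfold num
  rw [← Finset.card_union_of_disjoint, ← Finset.card_union_of_disjoint]
  · exact (Finset.card_le_univ _).trans_eq (Fintype.card_fin n)
  · rw [Finset.disjoint_left]
    intro i hi hi'
    have := h i (List.mem_toFinset.1 hi')
    simp [this] at hi
  · rw [Finset.disjoint_left]
    intro i hi hi'
    simp only [Finset.mem_filter, Finset.mem_univ, true_and] at hi hi'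
    simp [hi] at hi'

theorem isCertificate_true_iff {k : ℕ} {σ : PartialAssignment n} :
    IsCertificate (kOfN n k) true σ ↔ k ≤ num true σ := by
  unfold IsCertificate kOfN num
  simp only [decide_eq_true_eq]
  constructor
  · intro h
    -- The worst extension sets every unassigned variable to `0`.
    refine (h (fun i => decide (σ i = some true)) ?_).trans_eq ?_
    · intro i b hi
      cases b <;> simp [hi]
    · simp
  · intro h x hx
    refine h.trans (Finset.card_le_card ?_)
    intro i
    simpa using hx i true

theorem isCertificate_false_iff {k : ℕ} {σ : PartialAssignment n} :
    IsCertificate (kOfN n k) false σ ↔ n < k + num false σ := by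
  have hcard : ∀ x : Fin n → Bool, (Finset.univ.filter fun i => x i = true).card +
      (Finset.univ.filter fun i => x i = false).card = n := by
    intro x
    have := Finset.card_filter_add_card_filter_not (s := (Finset.univ : Finset (Fin n)))
      (fun i => x i = true)
    simpa using this
  unfold IsCertificate kOfN num
  simp only [decide_eq_false_iff_not, not_le]
  constructor
  · intro h
    -- The worst extension sets every unassigned variable to `1`.
    have h₁ := h (fun i => decide (σ i ≠ some false)) (by
      intro i b hi
      cases b <;> simp [hi])
    have h₂ := hcard (fun i => decide (σ i ≠ some false))
    simp only [ne_eq, decide_eq_false_iff_not, not_not] at h₁ h₂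
    omega
  · intro h x hx
    have h₁ := hcard x
    have h₂ : (Finset.univ.filter fun i => σ i = some false).card ≤
        (Finset.univ.filter fun i => x i = false).card := by
      refine Finset.card_le_card ?_
      intro i
      simpa using hx i false
    omega

theorem exists_isCertificate_iff {k : ℕ} {σ : PartialAssignment n} :
    (∃ ℓ, IsCertificate (kOfN n k) ℓ σ) ↔ n < k + num false σ ∨ k ≤ num true σ := by
  rw [Bool.exists_bool, isCertificate_true_iff, isCertificate_false_iff]

end Certificates

/-! ### The round robin is an elementary strategy. -/

section RoundRobin

variable {n : ℕ}

open PartialAssignment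

theorem roundList_flatten_perm {α : Type*} (A B : List α) :
    (roundList A B).flatten.Perm (A ++ B) := by
  induction A generalizing B with
  | nil =>
    have : (B.map fun b => [b]).flatten = B := by induction B <;> simp_all
    simp [roundList, this]
  | cons a A ih =>
    cases B with
    | nil =>
      have : (A.map fun b => [b]).flatten = A := by
        clear ih
        induction A <;> simp_all
      simp [roundList, this]
    | cons b B =>
      simp only [roundList, List.flatten_cons, List.cons_append, List.nil_append]
      refine List.Perm.cons a ?_
      exact ((ih B).cons b).trans List.perm_middle.symm

theorem vars_testAll_subset {next : PartialAssignment n → DecTree n} {R : Finset (Fin n)}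
    (h : ∀ σ, (next σ).vars ⊆ R) (l : List (Fin n)) (σ : PartialAssignment n) :
    (testAll l σ next).vars ⊆ l.toFinset ∪ R := by
  induction l generalizing σ with
  | nil => simpa [testAll] using h σ
  | cons i l ih =>
    simp only [testAll, DecTree.vars, List.toFinset_cons, Finset.insert_union]
    exact Finset.insert_subset_insert _ (Finset.union_subset (ih _) (ih _))

theorem isStrategy_testAll {next : PartialAssignment n → DecTree n} {R : Finset (Fin n)}
    (h : ∀ σ, (next σ).vars ⊆ R) (hs : ∀ σ, (next σ).IsStrategy) {l : List (Fin n)}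
    (hl : l.Nodup) (hd : ∀ i ∈ l, i ∉ R) (σ : PartialAssignment n) :
    (testAll l σ next).IsStrategy := by
  induction l generalizing σ with
  | nil => exact hs σ
  | cons i l ih =>
    obtain ⟨hi, hl⟩ := List.nodup_cons.1 hl
    have hd' : ∀ j ∈ l, j ∉ R := fun j hj => hd j (List.mem_cons_of_mem _ hj)
    have key : ∀ σ, i ∉ (testAll l σ next).vars := by
      intro σ hi'
      rcases Finset.mem_union.1 (vars_testAll_subset h l σ hi') with h' | h'
      · exact hi (List.mem_toFinset.1 h')
      · exact hd i List.mem_cons_self h'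
    exact ⟨key _, key _, ih hl hd' _, ih hl hd' _⟩

theorem vars_runRounds_subset (f : (Fin n → Bool) → Bool) (rs : List (List (Fin n)))
    (σ : PartialAssignment n) : (runRounds f rs σ).vars ⊆ rs.flatten.toFinset := by
  induction rs generalizing σ with
  | nil => simp [runRounds, DecTree.vars]
  | cons r rs ih =>
    simp only [runRounds]
    split_ifs
    · simp [DecTree.vars]
    · rw [List.flatten_cons, List.toFinset_append]
      exact vars_testAll_subset ih r σ

theorem isStrategy_runRounds (f : (Fin n → Bool) → Bool) {rs : List (List (Fin n))}
    (hrs : rs.flatten.Nodup) (σ : PartialAssignment n) : (runRounds f rs σ).IsStrategy := by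
  induction rs generalizing σ with
  | nil => trivial
  | cons r rs ih =>
    simp only [runRounds]
    rw [List.flatten_cons, List.nodup_append'] at hrs
    split_ifs
    · trivial
    · exact isStrategy_testAll (vars_runRounds_subset f rs) (ih hrs.2.1) hrs.1
        (fun i hi hi' => hrs.2.2 hi (List.mem_toFinset.1 hi')) σ

/-- Within a round the position alone determines the variable; after it, the history splits into the
part spent on the round and the rest. -/
theorem nodeAt_testAll {next : PartialAssignment n → DecTree n} {l : List (Fin n)}
    (hl : l.Nodup) {σ : PartialAssignment n} (hσ : ∀ i ∈ l, σ i = none) {h : List Bool}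
    {s : DecTree n} (hs : (testAll l σ next).nodeAt h = some s) :
    (h.length < l.length ∧ s.decision = l[h.length]?) ∨
      (l.length ≤ h.length ∧ ∃ σ', (∀ i ∉ l, σ' i = σ i) ∧
        (∀ b, num b σ' = num b σ + (h.take l.length).count b) ∧
        (next σ').nodeAt (h.drop l.length) = some s) := by
  induction l generalizing σ h with
  | nil => exact .inr ⟨Nat.zero_le _, σ, fun _ _ => rfl, by simp, by simpa [testAll] using hs⟩
  | cons i l ih =>
    obtain ⟨hi, hl⟩ := List.nodup_cons.1 hl
    cases h with
    | nil =>
      left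
      simp only [testAll, DecTree.nodeAt, Option.some.injEq] at hs
      subst hs
      simp [DecTree.decision]
    | cons v h =>
      have hs' : (testAll l (Function.update σ i (some v)) next).nodeAt h = some s := by
        cases v <;> simpa [testAll, DecTree.nodeAt] using hs
      have hne : ∀ j ∈ l, j ≠ i := fun j hj e => hi (e ▸ hj)
      rcases ih hl (σ := Function.update σ i (some v)) (fun j hj => by
        rw [Function.update_of_ne (hne j hj)]; exact hσ j (List.mem_cons_of_mem _ hj)) hs' with
        ⟨h₁, h₂⟩ | ⟨h₁, σ', h₂, h₃, h₄⟩
      · left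
        simpa using ⟨h₁, h₂⟩
      · right
        refine ⟨by simpa using h₁, σ', ?_, ?_, by simpa using h₄⟩
        · intro j hj
          rw [List.mem_cons, not_or] at hj
          rw [h₂ j hj.2, Function.update_of_ne hj.1]
        · intro b
          rw [h₃, num_update (hσ i List.mem_cons_self)]
          simp only [List.length_cons, List.take_succ_cons, List.count_cons, beq_iff_eq]
          omega

/-- The decision of the round strategy after `ℓ` tests if `a` zeros and `b` ones are known. -/
def roundsDecision (k : ℕ) : List (List (Fin n)) → ℕ → ℕ → ℕ → Option (Fin n)
  | [], _, _, _ => none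
  | r :: rs, a, b, ℓ =>
      if ℓ = 0 ∧ (n < k + a ∨ k ≤ b) then none
      else if ℓ < r.length then r[ℓ]? else roundsDecision k rs a b (ℓ - r.length)

/-- The number of tests so far locates the node in its round. Since the node is reached, no earlier
round has stopped, so certificates matter only when the node begins a round, and there the final
counts are the current ones. -/
theorem decision_of_nodeAt_runRounds {k : ℕ} {rs : List (List (Fin n))}
    (hrs : rs.flatten.Nodup) {σ : PartialAssignment n} (hσ : ∀ i ∈ rs.flatten, σ i = none)
    {h : List Bool} {s : DecTree n} (hs : (runRounds (kOfN n k) rs σ).nodeAt h = some s) :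
    s.decision = roundsDecision k rs (num false σ + h.count false)
      (num true σ + h.count true) h.length := by
  have hleaf : ∀ {h : List Bool} {s : DecTree n},
      (DecTree.leaf : DecTree n).nodeAt h = some s → h = [] ∧ s.decision = none := by
    intro h s hs
    cases h with
    | nil =>
      simp only [DecTree.nodeAt, Option.some.injEq] at hs
      subst hs
      exact ⟨rfl, rfl⟩
    | cons v h => simp [DecTree.nodeAt] at hs
  induction rs generalizing σ h with
  | nil => exact (hleaf hs).2
  | cons r rs ih =>
    simp only [runRounds, exists_isCertificate_iff] at hs
    rw [List.flatten_cons] at hσ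
    rw [List.flatten_cons, List.nodup_append'] at hrs
    split_ifs at hs with hc
    · obtain ⟨rfl, h⟩ := hleaf hs
      rw [h, roundsDecision, if_pos]
      simpa using hc
    · have hc' : ¬ (h.length = 0 ∧ (n < k + (num false σ + h.count false) ∨
          k ≤ num true σ + h.count true)) := by
        rintro ⟨h₀, h₁⟩
        rw [List.length_eq_zero_iff] at h₀
        subst h₀
        exact hc (by simpa using h₁)
      rw [roundsDecision, if_neg hc']
      rcases nodeAt_testAll hrs.1 (fun i hi => hσ i (List.mem_append_left _ hi)) hs with
        ⟨h₁, h₂⟩ | ⟨h₁, σ', h₂, h₃, h₄⟩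
      · rw [if_pos h₁, h₂]
      · rw [if_neg (not_lt.2 h₁)]
        rw [ih hrs.2.1 (fun i hi => by
          rw [h₂ i fun hi' => hrs.2.2 hi' hi]
          exact hσ i (List.mem_append_right _ hi)) h₄]
        have e : ∀ b, num b σ' + (h.drop r.length).count b = num b σ + h.count b := by
          intro b
          rw [h₃, add_assoc, ← List.count_append, List.take_append_drop]
        rw [e, e, List.length_drop]

theorem isElementary_runRounds (k : ℕ) {rs : List (List (Fin n))} (hrs : rs.flatten.Nodup) :
    (runRounds (kOfN n k) rs fun _ => none).IsElementary := by
  intro h h' s s' hs hs' h₀ h₁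
  have hlen : ∀ h : List Bool, h.length = h.count true + h.count false :=
    fun h => (List.count_true_add_count_false h).symm
  rw [decision_of_nodeAt_runRounds hrs (fun _ _ => rfl) hs,
    decision_of_nodeAt_runRounds hrs (fun _ _ => rfl) hs', h₀, h₁, hlen h, hlen h', h₀, h₁]

/-! ### Prunings attaining the optimal value of the rounds. -/

section Pruning

variable {p : Fin n → ℝ} {c : ℝ}

theorem exists_isPruning_testAll (hp : ∀ i, 0 ≤ p i ∧ p i ≤ 1) {g F : ℕ → ℝ}
    {next : PartialAssignment n → DecTree n} {l : List (Fin n)} (hl : l.Nodup)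
    {σ : PartialAssignment n} (hσ : ∀ i ∈ l, σ i = none)
    (h : ∀ σ' : PartialAssignment n, (∀ i ∉ l, σ' i = σ i) →
      ∃ t, DecTree.IsPruning t (next σ') ∧ F (num false σ') ≤ t.value g c p (num false σ')) :
    ∃ t, DecTree.IsPruning t (testAll l σ next) ∧
      -(c * l.length) + listExpect p l F (num false σ) ≤ t.value g c p (num false σ) := by
  induction l generalizing σ with
  | nil => simpa [testAll, listExpect] using h σ fun _ _ => rfl
  | cons i l ih =>
    obtain ⟨hi, hl⟩ := List.nodup_cons.1 hl
    have hσi := hσ i List.mem_cons_self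
    have hne : ∀ j ∈ l, j ≠ i := fun j hj e => hi (e ▸ hj)
    have key : ∀ v, ∃ t, DecTree.IsPruning t (testAll l (Function.update σ i (some v)) next) ∧
        -(c * l.length) + listExpect p l F (num false (Function.update σ i (some v))) ≤
          t.value g c p (num false (Function.update σ i (some v))) := by
      intro v
      refine ih hl (fun j hj => ?_) fun σ' hσ' => h σ' fun j hj => ?_
      · rw [Function.update_of_ne (hne j hj)]
        exact hσ j (List.mem_cons_of_mem _ hj)
      · rw [List.mem_cons, not_or] at hj
        rw [hσ' j hj.2, Function.update_of_ne hj.1]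
    obtain ⟨t₀, ht₀, h₀⟩ := key false
    obtain ⟨t₁, ht₁, h₁⟩ := key true
    refine ⟨.test i t₀ t₁, .test i ht₀ ht₁, ?_⟩
    simp only [num_update hσi, if_true, Bool.true_eq_false, if_false, add_zero] at h₀ h₁
    have := mul_le_mul_of_nonneg_left h₁ (hp i).1
    have := mul_le_mul_of_nonneg_left h₀ (sub_nonneg.2 (hp i).2)
    simp only [listExpect, DecTree.value, List.length_cons]
    push_cast
    linarith

theorem listExpect_le (hp : ∀ i, 0 ≤ p i ∧ p i ≤ 1) (l : List (Fin n)) {F : ℕ → ℝ} {C : ℝ}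
    {z : ℕ} (h : ∀ y ≤ z + l.length, F y ≤ C) : listExpect p l F z ≤ C := by
  induction l generalizing z with
  | nil => exact h z le_rfl
  | cons i l ih =>
    have := mul_le_mul_of_nonneg_left (ih (z := z) fun y hy => h y (by
      simp only [List.length_cons]; omega)) (hp i).1
    have := mul_le_mul_of_nonneg_left (ih (z := z + 1) fun y hy => h y (by
      simp only [List.length_cons]; omega)) (sub_nonneg.2 (hp i).2)
    simp only [listExpect]
    linarith

theorem roundsValue_le (hp : ∀ i, 0 ≤ p i ∧ p i ≤ 1) (hc : 0 ≤ c) {g : ℕ → ℝ} {C : ℝ}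
    {rs : List (List (Fin n))} {z : ℕ} (h : ∀ y ≤ z + rs.flatten.length, g y ≤ C) :
    roundsValue g c p rs z ≤ C := by
  induction rs generalizing z with
  | nil => exact h z (Nat.le_add_right _ _)
  | cons r rs ih =>
    simp only [List.flatten_cons, List.length_append] at h
    refine max_le (h z (Nat.le_add_right _ _)) ?_
    have h₁ : listExpect p r (roundsValue g c p rs) z ≤ C :=
      listExpect_le hp r fun y hy => ih fun y' hy' => h y' (by omega)
    have h₂ : 0 ≤ c * r.length := by positivity
    linarith

/-- The reward for knowing `z` zeros: `1` if they form a certificate of the `k`-of-`n` function. -/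
def zeroReward (n k : ℕ) (z : ℕ) : ℝ := if n < k + z then 1 else 0

theorem zeroReward_mono (n k : ℕ) : Monotone (zeroReward n k) := by
  intro y z h
  unfold zeroReward
  split_ifs <;> first | omega | norm_num

theorem zeroReward_le_one (n k z : ℕ) : zeroReward n k z ≤ 1 := by
  unfold zeroReward
  split_ifs <;> norm_num

/-- Prune wherever stopping attains the maximum in `roundsValue`. It remains to see that stopping is
also optimal where InsideOut stops by itself. -/
theorem exists_isPruning_runRounds (hp : ∀ i, 0 ≤ p i ∧ p i ≤ 1) (hc : 0 ≤ c) {k : ℕ}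
    {rs : List (List (Fin n))} (hrs : rs.flatten.Nodup) {σ : PartialAssignment n}
    (hσ : ∀ i ∈ rs.flatten, σ i = none) :
    ∃ t, DecTree.IsPruning t (runRounds (kOfN n k) rs σ) ∧
      roundsValue (zeroReward n k) c p rs (num false σ) ≤
        t.value (zeroReward n k) c p (num false σ) := by
  induction rs generalizing σ with
  | nil => exact ⟨.leaf, .leaf _, le_rfl⟩
  | cons r rs ih =>
    by_cases hcert : n < k + num false σ ∨ k ≤ num true σ
    · refine ⟨.leaf, .leaf _, roundsValue_le hp hc fun y hy => ?_⟩
      -- A `0`-certificate already earns the maximal reward 1. With `k` ones known, too few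
      -- variables remain for a `0`-certificate, so every reachable reward is 0.
      rcases hcert with h | h
      · simpa [DecTree.value, zeroReward, h] using zeroReward_le_one n k y
      · have := num_add_num_add_length_le hrs hσ
        have hy' : ¬ n < k + y := by omega
        simp only [DecTree.value, zeroReward, if_neg hy']
        split_ifs <;> norm_num
    · simp only [runRounds, exists_isCertificate_iff, if_neg hcert]
      rw [List.flatten_cons] at hσ
      rw [List.flatten_cons, List.nodup_append'] at hrs
      obtain ⟨t, ht, h⟩ := exists_isPruning_testAll (c := c) hp hrs.1
        (fun i hi => hσ i (List.mem_append_left _ hi)) fun σ' hσ' =>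
          ih hrs.2.1 fun i hi => by
            rw [hσ' i fun hi' => hrs.2.2 hi' hi]
            exact hσ i (List.mem_append_right _ hi)
      simp only [roundsValue]
      rcases le_total (zeroReward n k (num false σ)) (-(c * r.length) +
        listExpect p r (roundsValue (zeroReward n k) c p rs) (num false σ)) with hm | hm
      · exact ⟨t, ht, by rwa [max_eq_right hm]⟩
      · exact ⟨.leaf, .leaf _, by rw [max_eq_left hm]; exact le_rfl⟩

end Pruning

end RoundRobin

/-! ### From sums over assignments to the recursive value. -/

section Expectation

variable {n : ℕ} {p : Fin n → ℝ}

open PartialAssignment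

theorem assignmentProb_nonneg (hp : ∀ i, 0 ≤ p i ∧ p i ≤ 1) (x : Fin n → Bool) :
    0 ≤ assignmentProb p x := by
  refine Finset.prod_nonneg fun i _ => ?_
  split_ifs
  · exact (hp i).1
  · exact sub_nonneg.2 (hp i).2

theorem sum_assignmentProb (p : Fin n → ℝ) : ∑ x, assignmentProb p x = 1 := by
  have h := Finset.prod_univ_sum (fun _ : Fin n => (Finset.univ : Finset Bool))
    (fun i b => if b = true then p i else 1 - p i)
  rw [Fintype.piFinset_univ] at h
  unfold assignmentProb
  rw [← h]
  simp

/-- Independence of coordinate `i` from functions that ignore it; flipping this coordinate compares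
the halves `x i = true` and `x i = false`. -/
theorem sum_assignmentProb_ite (p : Fin n → ℝ) (i : Fin n) {G₀ G₁ : (Fin n → Bool) → ℝ}
    (h₀ : ∀ x v, G₀ (Function.update x i v) = G₀ x)
    (h₁ : ∀ x v, G₁ (Function.update x i v) = G₁ x) :
    ∑ x, assignmentProb p x * (if x i = true then G₁ x else G₀ x) =
      p i * ∑ x, assignmentProb p x * G₁ x + (1 - p i) * ∑ x, assignmentProb p x * G₀ x := by
  have flip : ∀ G : (Fin n → Bool) → ℝ, (∀ x v, G (Function.update x i v) = G x) →
      (1 - p i) * ∑ x, (if x i = true then assignmentProb p x * G x else 0) =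
        p i * ∑ x, (if x i = true then 0 else assignmentProb p x * G x) := by
    intro G hG
    rw [Finset.mul_sum, Finset.mul_sum]
    have hinv : Function.Involutive
        (fun x : Fin n → Bool => Function.update x i (!(x i))) := by
      intro x
      simp
    refine Fintype.sum_equiv hinv.toPerm _ _ fun x => ?_
    simp only [Function.Involutive.coe_toPerm, Function.update_self, hG]
    cases hx : x i with
    | false => simp
    | true =>
      simp only [if_true, Bool.not_true, Bool.false_eq_true, if_false]
      have e : ∀ y : Fin n → Bool, assignmentProb p y = (if y i = true then p i else 1 - p i) *
          ∏ j ∈ Finset.univ.erase i, if y j = true then p j else 1 - p j := fun y =>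
        (Finset.mul_prod_erase _ _ (Finset.mem_univ i)).symm
      have e' : (∏ j ∈ Finset.univ.erase i,
          if Function.update x i false j = true then p j else 1 - p j) =
          ∏ j ∈ Finset.univ.erase i, if x j = true then p j else 1 - p j := by
        refine Finset.prod_congr rfl fun j hj => ?_
        rw [Function.update_of_ne (Finset.ne_of_mem_erase hj)]
      rw [e, e (Function.update x i false), e']
      simp [hx]
      ring
  have split : ∀ G : (Fin n → Bool) → ℝ, ∑ x, assignmentProb p x * G x =
      ∑ x, (if x i = true then assignmentProb p x * G x else 0) +
        ∑ x, (if x i = true then 0 else assignmentProb p x * G x) := by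
    intro G
    rw [← Finset.sum_add_distrib]
    refine Finset.sum_congr rfl fun x _ => ?_
    split_ifs <;> simp
  have h := split fun x => if x i = true then G₁ x else G₀ x
  have c₁ : ∀ x : Fin n → Bool, (if x i = true then
      assignmentProb p x * (if x i = true then G₁ x else G₀ x) else 0) =
      if x i = true then assignmentProb p x * G₁ x else 0 := by
    intro x; split_ifs <;> rfl
  have c₀ : ∀ x : Fin n → Bool, (if x i = true then 0 else
      assignmentProb p x * (if x i = true then G₁ x else G₀ x)) =
      if x i = true then 0 else assignmentProb p x * G₀ x := by
    intro x; split_ifs <;> rfl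
  simp only [c₁, c₀] at h
  rw [h, split G₁, split G₀]
  linear_combination flip G₁ h₁ - flip G₀ h₀

namespace DecTree

theorem run_update_of_notMem {t : DecTree n} {i : Fin n} (hi : i ∉ t.vars) (x : Fin n → Bool)
    (v : Bool) (σ : PartialAssignment n) : t.run (Function.update x i v) σ = t.run x σ := by
  induction t generalizing σ with
  | leaf => rfl
  | test j t₀ t₁ h₀ h₁ =>
    simp only [vars, Finset.mem_insert, Finset.mem_union, not_or] at hi
    simp only [run, Function.update_of_ne (Ne.symm hi.1), h₀ hi.2.1, h₁ hi.2.2]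

theorem cost_update_of_notMem {t : DecTree n} {i : Fin n} (hi : i ∉ t.vars) (x : Fin n → Bool)
    (v : Bool) : t.cost (Function.update x i v) = t.cost x := by
  induction t with
  | leaf => rfl
  | test j t₀ t₁ h₀ h₁ =>
    simp only [vars, Finset.mem_insert, Finset.mem_union, not_or] at hi
    simp only [cost, Function.update_of_ne (Ne.symm hi.1), h₀ hi.2.1, h₁ hi.2.2]

theorem IsStrategy.sum_eq_value {t : DecTree n} (ht : t.IsStrategy) (g : ℕ → ℝ) (c : ℝ)
    {σ : PartialAssignment n} (hσ : ∀ i ∈ t.vars, σ i = none) :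
    ∑ x, assignmentProb p x * (g (num false (t.run x σ)) - c * t.cost x) =
      t.value g c p (num false σ) := by
  induction t generalizing σ with
  | leaf => simp [run, cost, value, ← Finset.sum_mul, sum_assignmentProb]
  | test i t₀ t₁ ih₀ ih₁ =>
    obtain ⟨hi₀, hi₁, ht₀, ht₁⟩ := ht
    simp only [vars, Finset.mem_insert, Finset.mem_union] at hσ
    have hσi := hσ i (.inl rfl)
    have e₀ := ih₀ ht₀ (σ := Function.update σ i (some false)) (fun j hj => by
      rw [Function.update_of_ne (by rintro rfl; exact hi₀ hj)]
      exact hσ j (.inr (.inl hj)))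
    have e₁ := ih₁ ht₁ (σ := Function.update σ i (some true)) (fun j hj => by
      rw [Function.update_of_ne (by rintro rfl; exact hi₁ hj)]
      exact hσ j (.inr (.inr hj)))
    simp only [num_update hσi, if_true, Bool.true_eq_false, if_false, add_zero] at e₀ e₁
    rw [value, ← e₀, ← e₁, ← sum_assignmentProb_ite p i]
    · have : -c = ∑ x, assignmentProb p x * (-c) := by
        rw [← Finset.sum_mul, sum_assignmentProb, one_mul]
      rw [this, ← Finset.sum_add_distrib]
      refine Finset.sum_congr rfl fun x _ => ?_
      rw [← mul_add]
      congr 1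
      simp only [run, cost]
      split_ifs <;> push_cast <;> ring
    · intro x v
      rw [run_update_of_notMem hi₀, cost_update_of_notMem hi₀]
    · intro x v
      rw [run_update_of_notMem hi₁, cost_update_of_notMem hi₁]

theorem IsStrategy.certProb_sub_eq_value {t : DecTree n} (ht : t.IsStrategy) (k : ℕ) (c : ℝ) :
    t.certProb p (kOfN n k) false - c * t.expectedCost p =
      t.value (zeroReward n k) c p 0 := by
  rw [← num_none (n := n) false, ← ht.sum_eq_value _ _ fun _ _ => rfl]
  unfold certProb expectedCost
  rw [Finset.mul_sum, ← Finset.sum_sub_distrib]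
  refine Finset.sum_congr rfl fun x _ => ?_
  simp only [isCertificate_false_iff, zeroReward, outcome]
  ring

theorem IsStrategy.cost_le_card {t : DecTree n} (ht : t.IsStrategy) (x : Fin n → Bool) :
    t.cost x ≤ t.vars.card := by
  induction t with
  | leaf => simp [cost]
  | test i t₀ t₁ ih₀ ih₁ =>
    obtain ⟨hi₀, hi₁, ht₀, ht₁⟩ := ht
    have a₀ := ih₀ ht₀
    have a₁ := ih₁ ht₁
    have b₀ := Finset.card_le_card (Finset.subset_union_left (s₁ := t₀.vars) (s₂ := t₁.vars))
    have b₁ := Finset.card_le_card (Finset.subset_union_right (s₁ := t₀.vars) (s₂ := t₁.vars))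
    simp only [cost, vars]
    rw [Finset.card_insert_of_notMem (by simp [hi₀, hi₁])]
    split_ifs <;> omega

theorem expectedCost_nonneg (hp : ∀ i, 0 ≤ p i ∧ p i ≤ 1) (t : DecTree n) :
    0 ≤ t.expectedCost p :=
  Finset.sum_nonneg fun x _ => mul_nonneg (assignmentProb_nonneg hp x) (Nat.cast_nonneg _)

theorem IsStrategy.expectedCost_le (hp : ∀ i, 0 ≤ p i ∧ p i ≤ 1) {t : DecTree n}
    (ht : t.IsStrategy) : t.expectedCost p ≤ n := by
  calc t.expectedCost p ≤ ∑ x, assignmentProb p x * (n : ℝ) := by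
        refine Finset.sum_le_sum fun x _ =>
          mul_le_mul_of_nonneg_left ?_ (assignmentProb_nonneg hp x)
        exact_mod_cast (ht.cost_le_card x).trans
          ((Finset.card_le_univ _).trans_eq (Fintype.card_fin n))
    _ = n := by rw [← Finset.sum_mul, sum_assignmentProb, one_mul]

theorem certProb_nonneg (hp : ∀ i, 0 ≤ p i ∧ p i ≤ 1) (f : (Fin n → Bool) → Bool) (ℓ : Bool)
    (t : DecTree n) : 0 ≤ t.certProb p f ℓ := by
  refine Finset.sum_nonneg fun x _ => mul_nonneg (assignmentProb_nonneg hp x) ?_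
  split_ifs <;> norm_num

theorem certProb_le_one (hp : ∀ i, 0 ≤ p i ∧ p i ≤ 1) (f : (Fin n → Bool) → Bool) (ℓ : Bool)
    (t : DecTree n) : t.certProb p f ℓ ≤ 1 := by
  rw [← sum_assignmentProb p]
  refine Finset.sum_le_sum fun x _ => ?_
  have := assignmentProb_nonneg hp x
  split_ifs <;> simp [this]

theorem IsPruning.vars_subset {t' t : DecTree n} (h : IsPruning t' t) : t'.vars ⊆ t.vars := by
  induction h with
  | leaf t => simp [vars]
  | test i _ _ h₀ h₁ => exact Finset.insert_subset_insert _ (Finset.union_subset_union h₀ h₁)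

theorem IsPruning.isStrategy {t' t : DecTree n} (h : IsPruning t' t) (ht : t.IsStrategy) :
    t'.IsStrategy := by
  induction h with
  | leaf t => trivial
  | test i h₀ h₁ ih₀ ih₁ =>
    obtain ⟨hi₀, hi₁, ht₀, ht₁⟩ := ht
    exact ⟨fun h => hi₀ (h₀.vars_subset h), fun h => hi₁ (h₁.vars_subset h), ih₀ ht₀, ih₁ ht₁⟩

theorem finite_setOf_isPruning (t : DecTree n) : {t' | IsPruning t' t}.Finite := by
  induction t with
  | leaf =>
    refine (Set.finite_singleton leaf).subset ?_
    intro t' h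
    cases h
    rfl
  | test i t₀ t₁ h₀ h₁ =>
    refine ((Set.Finite.image2 (test i) h₀ h₁).insert leaf).subset ?_
    intro t' h
    cases h with
    | leaf => exact .inl rfl
    | test _ a₀ a₁ => exact .inr ⟨_, a₀, _, a₁, rfl⟩

end DecTree

/-- The Lagrangian form of the result: one deterministic pruning for each price. -/
theorem exists_isPruning_roundRobin (hp : ∀ i, 0 < p i ∧ p i < 1) {L₀ L₁ : List (Fin n)}
    (hL : IsInsideOutOrder p L₀ L₁) (hnd : (roundList L₀ L₁).flatten.Nodup) (k : ℕ) {c : ℝ}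
    (hc : 0 ≤ c) {t : DecTree n} (ht : t.IsStrategy) :
    ∃ t', DecTree.IsPruning t' (roundRobin L₀ L₁ (kOfN n k)) ∧
      t.certProb p (kOfN n k) false - 4 * c * t.expectedCost p ≤
        t'.certProb p (kOfN n k) false - c * t'.expectedCost p := by
  have hp' : ∀ i, 0 ≤ p i ∧ p i ≤ 1 := fun i => ⟨(hp i).1.le, (hp i).2.le⟩
  have hg := zeroReward_mono n k
  obtain ⟨t', ht', h⟩ := exists_isPruning_runRounds (c := c) (k := k) hp' hc hnd
    (σ := fun _ => none) fun _ _ => rfl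
  refine ⟨t', ht', ?_⟩
  rw [ht.certProb_sub_eq_value,
    (ht'.isStrategy (isStrategy_runRounds _ hnd _)).certProb_sub_eq_value]
  rw [num_none] at h
  refine le_trans ?_ h
  -- The exchange argument is applied with `μ = 2 * c`, the maximal price of a round.
  rw [show 4 * c = 2 * (2 * c) by ring]
  refine DecTree.value_le_of_ordered hp (by positivity) hg
    (W := fun A B => roundsValue (zeroReward n k) c p (roundList A B))
    (fun A B z => le_roundsValue _ z)
    (fun a A B z => le_roundsValue_cons_left hp' hc hg a A B z)
    (fun A b B z => le_roundsValue_cons_right hp' hc hg A b B z)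
    _ L₀ L₁ rfl (fun i hi => (hL.mem₀ i).1 hi) (fun i hi => ((hL.mem₁ i).1 hi).le)
    hL.decreasing hL.increasing t ht ?_ 0
  intro i _
  rw [Finset.mem_union, List.mem_toFinset, List.mem_toFinset, hL.mem₀, hL.mem₁]
  exact le_or_gt _ _

end Expectation

/-! ### Convex duality and the passage to randomized strategies. -/

/-- If no mixture worked, a functional would strictly separate the compact set of mixtures from the
quadrant of acceptable pairs; since the quadrant is unbounded, the signs of its coefficients are
forced, and `h` contradicts it. -/
theorem exists_weights_of_forall_functional {α : Type*} (F : Finset α) (x y : α → ℝ) {X Y : ℝ}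
    (h : ∀ a b u : ℝ, a ≤ 0 → 0 ≤ b → (∀ t ∈ F, a * x t + b * y t < u) → a * X + b * Y ≤ u) :
    ∃ w : F → ℝ, w ∈ stdSimplex ℝ F ∧ ∑ t, w t * x t ≤ X ∧ Y ≤ ∑ t, w t * y t := by
  classical
  let L : (F → ℝ) →ₗ[ℝ] ℝ × ℝ :=
    { toFun := fun w => (∑ t, w t * x t, ∑ t, w t * y t)
      map_add' := by intro v w; ext <;> simp [add_mul, Finset.sum_add_distrib]
      map_smul' := by intro r w; ext <;> simp [mul_assoc, Finset.mul_sum] }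
  by_contra hcon
  have hdisj : Disjoint (L '' stdSimplex ℝ F) (Set.Iic X ×ˢ Set.Ici Y) := by
    rw [Set.disjoint_left]
    rintro _ ⟨w, hw, rfl⟩ ⟨h₁, h₂⟩
    exact hcon ⟨w, hw, h₁, h₂⟩
  obtain ⟨f, u, v, hu, huv, hv⟩ := geometric_hahn_banach_compact_closed
    ((convex_stdSimplex ℝ F).linear_image L)
    ((isCompact_stdSimplex ℝ F).image L.continuous_of_finiteDimensional)
    ((convex_Iic X).prod (convex_Ici Y)) (isClosed_Iic.prod isClosed_Ici) hdisj
  have hf : ∀ r s : ℝ, f (r, s) = f (1, 0) * r + f (0, 1) * s := by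
    intro r s
    have : ((r, s) : ℝ × ℝ) = r • ((1, 0) : ℝ × ℝ) + s • ((0, 1) : ℝ × ℝ) := by ext <;> simp
    rw [this, map_add, map_smul, map_smul, smul_eq_mul, smul_eq_mul, mul_comm r, mul_comm s]
  set a := f (1, 0)
  set b := f (0, 1)
  have hQ : ∀ r s : ℝ, r ≤ X → Y ≤ s → v < a * r + b * s := fun r s hr hs => by
    rw [← hf]; exact hv _ ⟨hr, hs⟩
  have h₀ := hQ X Y le_rfl le_rfl
  have ha : a ≤ 0 := by
    by_contra! ha
    -- The shift is chosen so that the functional would equal `v` at the new point.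
    have := hQ (X - (a * X + b * Y - v) / a) Y
      (sub_le_self _ (div_nonneg (by linarith) ha.le)) le_rfl
    have e : a * ((a * X + b * Y - v) / a) = a * X + b * Y - v := by field_simp
    linarith
  have hb : 0 ≤ b := by
    by_contra! hb
    have := hQ X (Y + (a * X + b * Y - v) / (-b)) le_rfl
      (le_add_of_nonneg_right (div_nonneg (by linarith) (by linarith)))
    have e : b * ((a * X + b * Y - v) / (-b)) = -(a * X + b * Y - v) := by
      have := hb.ne
      field_simp
    linarith
  have := h a b u ha hb fun t ht => by
    have := hu (L (Pi.single ⟨t, ht⟩ 1)) ⟨_, single_mem_stdSimplex ℝ _, rfl⟩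
    have e : L (Pi.single ⟨t, ht⟩ 1) = (x t, y t) := by
      simp [L, Pi.single_apply]
    rwa [e, hf] at this
  linarith

theorem exists_pmf_of_weights {α : Type*} (F : Finset α) {x y : α → ℝ} (hx : ∀ t, 0 ≤ x t)
    (hy : ∀ t, 0 ≤ y t) {w : F → ℝ} (hw : w ∈ stdSimplex ℝ F) :
    ∃ S : PMF α, (∀ t ∈ S.support, t ∈ F) ∧
      ∑' t, S t * ENNReal.ofReal (x t) = ENNReal.ofReal (∑ t, w t * x t) ∧
      ∑' t, S t * ENNReal.ofReal (y t) = ENNReal.ofReal (∑ t, w t * y t) := by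
  classical
  let m : α → ℝ≥0∞ := fun t => if h : t ∈ F then ENNReal.ofReal (w ⟨t, h⟩) else 0
  have hm : ∀ t ∉ F, m t = 0 := fun t ht => dif_neg ht
  have hmF : ∀ t : F, m t = ENNReal.ofReal (w t) := fun t => dif_pos t.2
  have hsum : ∀ r : α → ℝ, (∀ t, 0 ≤ r t) →
      ∑ t ∈ F, m t * ENNReal.ofReal (r t) = ENNReal.ofReal (∑ t, w t * r t) := by
    intro r hr
    rw [ENNReal.ofReal_sum_of_nonneg fun t _ => mul_nonneg (hw.1 t) (hr t),
      ← Finset.sum_coe_sort]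
    refine Finset.sum_congr rfl fun t _ => ?_
    rw [hmF, ENNReal.ofReal_mul (hw.1 t)]
  have h₁ : ∑ t ∈ F, m t = 1 := by
    have := hsum (fun _ => 1) fun _ => zero_le_one
    simp only [mul_one, ENNReal.ofReal_one] at this
    rw [this, hw.2, ENNReal.ofReal_one]
  refine ⟨PMF.ofFinset m F h₁ hm, fun t ht => ?_, ?_, ?_⟩
  · by_contra h
    exact (PMF.mem_support_iff _ _).1 ht (hm t h)
  · rw [← hsum x hx]
    exact tsum_eq_sum fun t ht => by simp [hm t ht]
  · rw [← hsum y hy]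
    exact tsum_eq_sum fun t ht => by simp [hm t ht]

/-- The type of trees may be infinite; boundedness on the support gives the summability needed to
compute with real numbers. -/
theorem PMF.tsum_mul_ofReal_eq {α : Type*} (S : PMF α) {x : α → ℝ} {C : ℝ} (hx : ∀ t, 0 ≤ x t)
    (hC : ∀ t ∈ S.support, x t ≤ C) :
    Summable (fun t => (S t).toReal * x t) ∧
      ∑' t, S t * ENNReal.ofReal (x t) = ENNReal.ofReal (∑' t, (S t).toReal * x t) := by
  have hs : Summable fun t => (S t).toReal := ENNReal.summable_toReal (by simp [S.tsum_coe])
  have hn : ∀ t, 0 ≤ (S t).toReal * x t := fun t => mul_nonneg ENNReal.toReal_nonneg (hx t)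
  have hsx : Summable fun t => (S t).toReal * x t := by
    refine Summable.of_nonneg_of_le hn (fun t => ?_) (hs.mul_right C)
    by_cases ht : t ∈ S.support
    · exact mul_le_mul_of_nonneg_left (hC t ht) ENNReal.toReal_nonneg
    · rw [PMF.mem_support_iff, not_not] at ht
      simp [ht]
  refine ⟨hsx, ?_⟩
  rw [ENNReal.ofReal_tsum_of_nonneg hn hsx]
  refine tsum_congr fun t => ?_
  rw [ENNReal.ofReal_mul ENNReal.toReal_nonneg, ENNReal.ofReal_toReal (S.apply_ne_top t)]

theorem mainTheorem3 (n k : ℕ) (p : Fin n → ℝ) (hp : ∀ i, 0 < p i ∧ p i < 1)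
    (L₀ L₁ : List (Fin n)) (hL : IsInsideOutOrder p L₀ L₁)
    (S : PMF (DecTree n)) (hS : IsRandomizedStrategy S) :
    (roundRobin L₀ L₁ (kOfN n k)).IsStrategy ∧
    (roundRobin L₀ L₁ (kOfN n k)).IsElementary ∧
    ∃ S' : PMF (DecTree n),
      IsRandomizedPruning S' (roundRobin L₀ L₁ (kOfN n k)) ∧
      expectedCost p S' ≤ 6 * expectedCost p S ∧
      certProb p (kOfN n k) false S ≤ certProb p (kOfN n k) false S' := by
  have hp' : ∀ i, 0 ≤ p i ∧ p i ≤ 1 := fun i => ⟨(hp i).1.le, (hp i).2.le⟩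
  have hnd : (roundList L₀ L₁).flatten.Nodup := by
    rw [(roundList_flatten_perm L₀ L₁).nodup_iff, List.nodup_append']
    refine ⟨hL.nodup₀, hL.nodup₁, fun i h₀ h₁ => ?_⟩
    exact absurd ((hL.mem₁ i).1 h₁) (not_lt.2 ((hL.mem₀ i).1 h₀))
  refine ⟨isStrategy_runRounds _ hnd _, isElementary_runRounds k hnd, ?_⟩
  have hfin := DecTree.finite_setOf_isPruning (roundRobin L₀ L₁ (kOfN n k))
  have hcost : ∀ t : DecTree n, 0 ≤ t.expectedCost p := DecTree.expectedCost_nonneg hp'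
  have hcert : ∀ t : DecTree n, 0 ≤ t.certProb p (kOfN n k) false :=
    DecTree.certProb_nonneg hp' _ _
  obtain ⟨sB, eB⟩ := S.tsum_mul_ofReal_eq hcost fun t ht => (hS t ht).expectedCost_le hp'
  obtain ⟨sP, eP⟩ := S.tsum_mul_ofReal_eq hcert fun t _ => DecTree.certProb_le_one hp' _ _ t
  set B := ∑' t, (S t).toReal * t.expectedCost p
  set P := ∑' t, (S t).toReal * t.certProb p (kOfN n k) false
  have hB : 0 ≤ B := tsum_nonneg fun t => mul_nonneg ENNReal.toReal_nonneg (hcost t)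
  obtain ⟨w, hw, hw₁, hw₂⟩ := exists_weights_of_forall_functional hfin.toFinset
    (fun t => t.expectedCost p) (fun t => t.certProb p (kOfN n k) false) (X := 4 * B) (Y := P) (by
      intro a b u ha hb h
      rcases hb.eq_or_lt with rfl | hb
      -- With `b = 0` there is no price `-a / b`; the pruning that stops at once has cost 0, which
      -- forces `0 < u`.
      · have := h .leaf (by simpa using DecTree.IsPruning.leaf _)
        have e : (DecTree.leaf : DecTree n).expectedCost p = 0 := by
          simp [DecTree.expectedCost, DecTree.cost]
        rw [e] at this
        have := mul_nonpos_of_nonpos_of_nonneg ha hB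
        linarith
      have hone : ∑' t, (S t).toReal = 1 := by
        rw [← ENNReal.tsum_toReal_eq S.apply_ne_top, S.tsum_coe, ENNReal.toReal_one]
      have hs : Summable fun t => (S t).toReal := ENNReal.summable_toReal (by simp [S.tsum_coe])
      have hle : ∀ t, 4 * a * ((S t).toReal * t.expectedCost p) +
          b * ((S t).toReal * t.certProb p (kOfN n k) false) ≤ (S t).toReal * u := by
        intro t
        by_cases ht : t ∈ S.support
        -- The functional divided by `b` is success minus cost at price `-a / b`; averaging the
        -- resulting bounds over `S` gives the claim.
        · obtain ⟨t', ht', h'⟩ := exists_isPruning_roundRobin hp hL hnd k (c := -a / b)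
            (div_nonneg (neg_nonneg.2 ha) hb.le) (hS t ht)
          have h₁ := h t' (by simpa using ht')
          have h₂ := mul_le_mul_of_nonneg_left h' hb.le
          have e : ∀ r, b * (-a / b * r) = -a * r := fun r => by field_simp
          have e₁ := e (t.expectedCost p)
          have e₂ := e (t'.expectedCost p)
          have h₃ : 4 * a * t.expectedCost p + b * t.certProb p (kOfN n k) false ≤ u := by
            linarith
          have := mul_le_mul_of_nonneg_left h₃ (ENNReal.toReal_nonneg (a := S t))
          linarith
        · rw [PMF.mem_support_iff, not_not] at ht
          simp [ht]
      have := Summable.tsum_le_tsum hle ((sB.mul_left _).add (sP.mul_left _)) (hs.mul_right u)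
      rw [(sB.mul_left _).tsum_add (sP.mul_left _), tsum_mul_left, tsum_mul_left,
        tsum_mul_right, hone] at this
      linarith)
  obtain ⟨S', hS', h₁, h₂⟩ := exists_pmf_of_weights hfin.toFinset hcost hcert hw
  refine ⟨S', fun t ht => by simpa using hS' t ht, ?_, ?_⟩
  · unfold expectedCost
    rw [h₁, eB, show (6 : ℝ≥0∞) = ENNReal.ofReal 6 by simp, ← ENNReal.ofReal_mul (by norm_num)]
    exact ENNReal.ofReal_le_ofReal (by linarith)
  · unfold certProb
    rw [h₂, eP]
    exact ENNReal.ofReal_le_ofReal hw₂
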